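/- For $m\ge 0$ let $\mathbb{S}^m=\{x\in\mathbb{R}^{m+1}:\|x\|=1\}$ carry the geodesic distance $d(x,x')=\arccos\langle x,x'\rangle$, and let $\mathbf{H}_{\ge 0}(\mathbb{S}^2)=\{x\in\mathbb{S}^2: x_3\ge 0\}$ carry the restricted distance. A correspondence between sets $X$ and $Y$ is a relation $R\subseteq X\times Y$ whose projections to $X$ and to $Y$ are onto; for metric spaces $X,Y$ its distortion is $\operatorname{dis}(R)=\sup_{(x,y),(x',y')\in R}|d_X(x,x')-d_Y(y,y')|$. The Gromov-Hausdorff distance $d_{GH}(X,Y)$ is the infimum of the Hausdorff distances $d_H(f(X),g(Y))$ over all metric spaces $Z$ and all isometric embeddings $f:X\to Z$, $g:Y\to Z$. There exist (1) a correspondence $R_1$ between $\mathbb{S}^1$ and $\mathbf{H}_{\ge 0}(\mathbb{S}^2)$ and (2) a correspondence $R_2$ between $\mathbb{S}^1$ and $\mathbb{S}^2$, both of distortion at most $\frac{2\pi}{3}$. They can be taken to be the graphs (with the coordinates swapped) of the following maps $\psi:\mathbf{H}_{\ge 0}(\mathbb{S}^2)\to\mathbb{S}^1$ and $\varphi:\mathbb{S}^2\to\mathbb{S}^1$.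 Let $w_1=(1,0)$, $w_2=(-\frac12,\frac{\sqrt3}{2})$, $w_3=(-\frac12,-\frac{\sqrt3}{2})$ and $u_i=(w_i,0)\in\mathbb{S}^2$. Then $\psi(x,0)=x$ for $x\in\mathbb{S}^1$, and, for $p\in\mathbb{S}^2$ with $p_3>0$, $\psi(p)=w_i$, where $i$ is the smallest index for which $d(p,u_i)=\min_j d(p,u_j)$. The map $\varphi$ is the antipode preserving map ($\varphi(-p)=-\varphi(p)$ for all $p$) that agrees with $\psi$ on the set of all $p\in\mathbb{S}^2$ with $p_3>0$, or $p_3=0$ and $p_2>0$, or $p=(1,0,0)$. Moreover, $d_{GH}(\mathbb{S}^1,\mathbb{S}^2)=\frac{\pi}{3}$. -/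

import Mathlib

open scoped ENNReal

noncomputable section

/-- The unit sphere `S^m` in `ℝ^(m+1)`.  It is a type of its own, so that it carries the geodesic
distance defined below and not the Euclidean one. -/
@[ext]
structure GeoSphere (m : ℕ) where
  val : EuclideanSpace ℝ (Fin (m + 1))
  norm_val : ‖val‖ = 1

namespace GeoSphere

variable {m : ℕ}

theorem val_ne_zero (x : GeoSphere m) : x.val ≠ 0 := by
  intro h
  have := x.norm_val
  simp [h] at this

/-- The geodesic distance `d(x, y) = arccos ⟨x, y⟩`. -/
instance : Dist (GeoSphere m) where
  dist x y := Real.arccos (inner ℝ x.val y.val)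

theorem dist_def (x y : GeoSphere m) : dist x y = Real.arccos (inner ℝ x.val y.val) := rfl

theorem dist_eq_angle (x y : GeoSphere m) :
    dist x y = InnerProductGeometry.angle x.val y.val := by
  simp [dist_def, InnerProductGeometry.angle, x.norm_val, y.norm_val]

instance : MetricSpace (GeoSphere m) where
  dist_self x := by
    rw [dist_eq_angle, InnerProductGeometry.angle_self x.val_ne_zero]
  dist_comm x y := by
    rw [dist_eq_angle, dist_eq_angle, InnerProductGeometry.angle_comm]
  dist_triangle x y z := by
    simp only [dist_eq_angle]
    exact InnerProductGeometry.angle_le_angle_add_angle _ _ _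
  eq_of_dist_eq_zero := by
    intro x y h
    rw [dist_eq_angle, ← InnerProductGeometry.inner_eq_mul_norm_iff_angle_eq_zero
      x.val_ne_zero y.val_ne_zero, x.norm_val, y.norm_val, mul_one,
      inner_eq_one_iff_of_norm_eq_one x.norm_val y.norm_val] at h
    exact GeoSphere.ext h

instance : CompactSpace (GeoSphere m) := by
  let f : Metric.sphere (0 : EuclideanSpace ℝ (Fin (m + 1))) 1 → GeoSphere m :=
    fun x => ⟨x.1, by simp⟩
  have hf : Continuous f := by
    refine continuous_iff_continuousAt.2 fun x => tendsto_iff_dist_tendsto_zero.2 ?_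
    have hc : Continuous fun y : Metric.sphere (0 : EuclideanSpace ℝ (Fin (m + 1))) 1 =>
        Real.arccos (inner ℝ y.1 x.1) :=
      Real.continuous_arccos.comp (continuous_subtype_val.inner continuous_const)
    have h := hc.tendsto x
    have h0 : Real.arccos (inner ℝ x.1 x.1) = 0 := by
      simp
    rw [h0] at h
    exact h
  have hs : Function.Surjective f := fun y => ⟨⟨y.val, by simp [y.norm_val]⟩, rfl⟩
  exact ⟨by rw [← hs.range_eq]; exact isCompact_range hf⟩

instance : Nonempty (GeoSphere m) :=
  ⟨⟨EuclideanSpace.single 0 1, by simp⟩⟩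

/-- The antipodal map `x ↦ -x`. -/
instance : Neg (GeoSphere m) where
  neg x := ⟨-x.val, by rw [norm_neg, x.norm_val]⟩

/-- The closed upper hemisphere of `S^m`: the last coordinate is nonnegative.  Used as a type it
carries the restriction of the geodesic distance of `S^m`. -/
def closedUpperHemisphere (m : ℕ) : Set (GeoSphere m) :=
  {x | 0 ≤ x.val (Fin.last m)}

/-- The open upper hemisphere of `S^m`: the last coordinate is positive. -/
def openUpperHemisphere (m : ℕ) : Set (GeoSphere m) :=
  {x | 0 < x.val (Fin.last m)}

/-- The equatorial embedding `S^m → S^(m+1)`, `(x_1, …, x_(m+1)) ↦ (x_1, …, x_(m+1), 0)`. -/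
def equatorial (x : GeoSphere m) : GeoSphere (m + 1) where
  val := WithLp.toLp 2 (Fin.snoc (α := fun _ => ℝ) (fun i => x.val i) 0)
  norm_val := by
    have h := x.norm_val
    rw [EuclideanSpace.norm_eq] at h ⊢
    rw [Fin.sum_univ_castSucc]
    simpa using h

theorem equatorial_mem_closedUpperHemisphere (x : GeoSphere m) :
    x.equatorial ∈ closedUpperHemisphere (m + 1) := by
  simp [closedUpperHemisphere, equatorial]

/-- A fundamental domain of the antipodal map: `A(S^0) = {1}`, and `A(S^(n+1))` is the union of the
open upper hemisphere of `S^(n+1)` and the copy of `A(S^n)` in the equator. -/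
def helmet : (n : ℕ) → Set (GeoSphere n)
  | 0 => {x | x.val 0 = 1}
  | n + 1 => openUpperHemisphere (n + 1) ∪ equatorial '' helmet n

/-- The vertices of a regular triangle inscribed in `S^1`. -/
def triangle (i : Fin 3) : GeoSphere 1 where
  val := ![!₂[1, 0], !₂[-1 / 2, √3 / 2], !₂[-1 / 2, -(√3 / 2)]] i
  norm_val := by
    have h3 : (√3 : ℝ) ^ 2 = 3 := Real.sq_sqrt (by norm_num)
    rw [EuclideanSpace.norm_eq, Real.sqrt_eq_one]
    fin_cases i <;> simp [Fin.sum_univ_two, div_pow, h3] <;> norm_num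

/-- The Voronoi cell in the open upper hemisphere of `S^2` of the `i`-th vertex of the triangle,
placed in the equator.  Ties go to the smallest index. -/
def voronoiCell (i : Fin 3) : Set (GeoSphere 2) :=
  {x | x ∈ openUpperHemisphere 2 ∧
    (∀ j, j ≠ i → dist x (triangle i).equatorial ≤ dist x (triangle j).equatorial) ∧
    (∀ j, j < i → dist x (triangle i).equatorial < dist x (triangle j).equatorial)}

/-- `ψ` is the map from the closed upper hemisphere to `S^1` that is constant on each Voronoi cell,
with value the vertex of that cell, and that is the identity on the equator. -/
def IsVoronoiMap (ψ : closedUpperHemisphere 2 → GeoSphere 1) : Prop :=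
  (∀ (i : Fin 3) (p : closedUpperHemisphere 2), p.1 ∈ voronoiCell i → ψ p = triangle i) ∧
  (∀ x : GeoSphere 1, ψ ⟨x.equatorial, x.equatorial_mem_closedUpperHemisphere⟩ = x)

/-- `φ` is the antipode preserving map on `S^2` that agrees with `ψ` on `A(S^2)`. -/
def IsOddExtension (ψ : closedUpperHemisphere 2 → GeoSphere 1) (φ : GeoSphere 2 → GeoSphere 1) :
    Prop :=
  (∀ x : GeoSphere 2, φ (-x) = -φ x) ∧
  (∀ p : closedUpperHemisphere 2, p.1 ∈ helmet 2 → φ p.1 = ψ p)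

end GeoSphere

/-- A relation `R ⊆ X × Y` is a correspondence if both projections map it onto the factor. -/
def IsCorrespondence {X Y : Type*} (R : Set (X × Y)) : Prop :=
  Prod.fst '' R = Set.univ ∧ Prod.snd '' R = Set.univ

/-- The distortion of a relation, the supremum of `|d(x, x') - d(y, y')|` over `(x, y)` and
`(x', y')` in `R`, as an extended nonnegative real. -/
def distortion {X Y : Type*} [MetricSpace X] [MetricSpace Y] (R : Set (X × Y)) : ℝ≥0∞ :=
  ⨆ p ∈ R, ⨆ q ∈ R, ENNReal.ofReal |dist p.1 q.1 - dist p.2 q.2|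

/-- The graph of a map `f : Y → X`, as a relation between `X` and `Y`. -/
def graphRel {X Y : Type*} (f : Y → X) : Set (X × Y) :=
  {p | f p.2 = p.1}

end

/-! Lower bound: making a map from a higher sphere to the circle odd, by redefining it on one point
of each antipodal pair, does not increase its distortion. An odd map has arbitrarily close points
whose images are at least `2π/3` apart (Dubins–Schwarz): a continuous average of nearby values has,
by the Borsuk–Ulam theorem, an odd part with a zero, so some nearby values have a vanishing convex
combination; at most three of them are needed, and then some two have inner product at most
`-1/2`.

Upper bound: two different vertices of the triangle are exactly `2π/3` apart, while the distances
on the sphere lie between `0` and `π`. The critical point is thus that a Voronoi cell has diameter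
at most `2π/3`. A horizontal vector `v` is determined by the triple `⟨v, wᵢ⟩`, which sums to zero,
and for two points in the same cell these triples attain their maximum at the same index. -/

open Module Metric
open scoped Real

/-- The map `f` changes distances by at most `D`, i.e. its graph has distortion at most `D`. -/
def DistortionLE {X Y : Type*} [Dist X] [Dist Y] (f : X → Y) (D : ℝ) : Prop :=
  ∀ x y, |dist (f x) (f y) - dist x y| ≤ D

/-! ### The Borsuk–Ulam theorem for maps to the plane -/

/-- The difference `u (-w) - u w` of values of a continuous logarithm `u` of `f` is constant on the
connected sphere and changes sign with `w`, so it vanishes, although its exponential is `-1`. -/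
theorem exists_eq_zero_of_odd_on_sphere {W : Type*} [NormedAddCommGroup W] [NormedSpace ℝ W]
    (hW : 1 < Module.rank ℝ W) {r : ℝ} (hr : 0 ≤ r) {f : W → ℂ} (hf : Continuous f)
    (hodd : ∀ w, ‖w‖ = r → f (-w) = -f w) : ∃ w, f w = 0 := by
  by_contra! hne
  obtain ⟨u, ⟨-, hu⟩, -⟩ := Complex.isCoveringMapOn_exp.existsUnique_continuousMap_lifts
    (⟨f, hf⟩ : C(W, ℂ)) (a₀ := 0) (e₀ := Complex.log (f 0))
    (Complex.exp_log (hne 0)) (fun w => by simpa using hne w)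
  have hexp (w : W) : Complex.exp (u w) = f w := congrFun hu w
  let jump (w : W) : ℂ := u (-w) - u w
  have exp_jump {w : W} (hw : w ∈ sphere 0 r) : Complex.exp (jump w) = -1 := by
    rw [Complex.exp_sub, hexp, hexp, hodd w (mem_sphere_zero_iff_norm.1 hw), neg_div,
      div_self (hne w)]
  obtain ⟨w, hw⟩ := (isConnected_sphere hW (0 : W) hr).nonempty
  have hw' : -w ∈ sphere (0 : W) r := by simpa using hw
  have jump_neg : jump (-w) = -jump w := by simp only [jump, neg_neg, neg_sub]
  have jump_const : jump (-w) = jump w :=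
    Complex.isCoveringMap_exp.constOn_of_comp (isPreconnected_sphere hW 0 r)
      (by fun_prop) (fun x hx y hy => Subtype.ext ((exp_jump hx).trans (exp_jump hy).symm)) hw' hw
  have jump_eq_zero : jump w = 0 := self_eq_neg.1 (jump_const.symm.trans jump_neg)
  have := exp_jump hw
  norm_num [jump_eq_zero] at this

/-- Inverse stereographic projection is odd on the preimage of the equator, the sphere of
radius `2`. -/
theorem exists_eq_zero_of_odd_of_two_lt_finrank {E : Type*} [NormedAddCommGroup E]
    [InnerProductSpace ℝ E] (hE : 2 < finrank ℝ E) {f : sphere (0 : E) 1 → ℂ}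
    (hf : Continuous f) (hodd : ∀ x, f (-x) = -f x) : ∃ x, f x = 0 := by
  have : FiniteDimensional ℝ E := .of_finrank_pos (by lia)
  have : Nontrivial E := nontrivial_of_finrank_pos (R := ℝ) (by lia)
  obtain ⟨v, hv⟩ := exists_norm_eq E zero_le_one
  have hrank : 1 < Module.rank ℝ (ℝ ∙ v)ᗮ := by
    have := (ℝ ∙ v).finrank_add_finrank_orthogonal
    rw [finrank_span_singleton (norm_ne_zero_iff.1 (by simp [hv]))] at this
    rw [← finrank_eq_rank]
    exact_mod_cast (by lia : 1 < finrank ℝ (ℝ ∙ v)ᗮ)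
  have stereo_neg (w : (ℝ ∙ v)ᗮ) (hw : ‖w‖ = 2) : stereoInvFun hv (-w) = -stereoInvFun hv w := by
    ext1
    simp only [stereoInvFun_apply, norm_neg, hw, NegMemClass.coe_neg, coe_neg_sphere]
    module
  obtain ⟨w, hw⟩ := exists_eq_zero_of_odd_on_sphere hrank zero_le_two
    (hf.comp (continuous_stereoInvFun hv)) fun w hw => by
      rw [Function.comp_apply, Function.comp_apply, stereo_neg w hw, hodd]
  exact ⟨_, hw⟩

/-! ### Inequalities for vanishing sums -/

/-- Pair the relation with the point of largest weight. -/
theorem exists_card_sub_one_mul_inner_le_neg_one {ι E : Type*} [Fintype ι] [Nonempty ι]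
    [NormedAddCommGroup E] [InnerProductSpace ℝ E] {z : ι → E} (hz : ∀ i, ‖z i‖ = 1) {a : ι → ℝ}
    (ha : ∀ i, 0 < a i) (h0 : ∑ i, a i • z i = 0) :
    ∃ i j, (Fintype.card ι - 1) * inner ℝ (z i) (z j) ≤ -1 := by
  classical
  obtain ⟨i, hi⟩ := Finite.exists_max a
  have hcard : ((Finset.univ.erase i).card : ℝ) = Fintype.card ι - 1 := by
    rw [Finset.cast_card_erase_of_mem (Finset.mem_univ i), Finset.card_univ]
  have hsum : ∑ j ∈ Finset.univ.erase i, a j * inner ℝ (z i) (z j) = -a i := by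
    have h : ∑ j, a j * inner ℝ (z i) (z j) = 0 := by
      simp_rw [← inner_smul_right, ← inner_sum, h0, inner_zero_right]
    rw [← Finset.add_sum_erase _ _ (Finset.mem_univ i), real_inner_self_eq_norm_sq, hz i] at h
    linarith
  have hne : (Finset.univ.erase i).Nonempty :=
    Finset.nonempty_of_sum_ne_zero (hsum.trans_ne (neg_ne_zero.2 (ha i).ne'))
  obtain ⟨j, -, hj⟩ : ∃ j ∈ Finset.univ.erase i,
      (Fintype.card ι - 1) * (a j * inner ℝ (z i) (z j)) ≤ -a i := by
    refine Finset.exists_le_of_sum_le hne ?_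
    rw [← Finset.mul_sum, hsum, Finset.sum_const, nsmul_eq_mul, hcard]
  refine ⟨i, j, le_of_mul_le_mul_left ?_ (ha j)⟩
  linarith [hi j]

/-- By Carathéodory's theorem at most `finrank ℝ E + 1` of the points are needed. -/
theorem exists_inner_le_of_zero_mem_convexHull {E : Type*} [NormedAddCommGroup E]
    [InnerProductSpace ℝ E] [FiniteDimensional ℝ E] {s : Set E} (hs : ∀ x ∈ s, ‖x‖ = 1)
    (h0 : 0 ∈ convexHull ℝ s) :
    ∃ x ∈ s, ∃ y ∈ s, inner ℝ x y ≤ -(finrank ℝ E : ℝ)⁻¹ := by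
  obtain ⟨ι, _, z, a, hzs, hind, ha, ha1, haz⟩ := eq_pos_convex_span_of_mem_convexHull h0
  have hz (i : ι) : z i ∈ s := hzs ⟨i, rfl⟩
  have : Nonempty ι := by
    by_contra! hι
    simp at ha1
  obtain ⟨i, j, hij⟩ := exists_card_sub_one_mul_inner_le_neg_one (fun i => hs _ (hz i)) ha haz
  have hcard : (Fintype.card ι - 1 : ℝ) ≤ finrank ℝ E := by
    rw [sub_le_iff_le_add]
    exact_mod_cast hind.card_le_finrank_succ.trans
      (Nat.succ_le_succ (Submodule.finrank_le (vectorSpan ℝ (Set.range z))))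
  have hcard_nonneg : (0 : ℝ) ≤ Fintype.card ι - 1 :=
    sub_nonneg.2 (by exact_mod_cast Fintype.card_pos)
  have hneg : inner ℝ (z i) (z j) < 0 := by
    by_contra! h
    linarith [mul_nonneg hcard_nonneg h]
  have hmul : (finrank ℝ E : ℝ) * inner ℝ (z i) (z j) ≤ -1 :=
    (mul_le_mul_of_nonpos_right hcard hneg.le).trans hij
  have hpos : (0 : ℝ) < finrank ℝ E :=
    pos_of_mul_neg_left (hmul.trans_lt neg_one_lt_zero) hneg.le
  refine ⟨z i, hz i, z j, hz j, ?_⟩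
  rwa [inv_eq_one_div, ← neg_div, le_div_iff₀' hpos]

section SumEqZero

variable {ι R : Type*} [Fintype ι] [CommRing R] [LinearOrder R] [IsStrictOrderedRing R]

theorem card_mul_sq_le_of_sum_eq_zero {c : ι → R} (hc : ∑ j, c j = 0) (i : ι) :
    Fintype.card ι * c i ^ 2 ≤ (Fintype.card ι - 1) * ∑ j, c j ^ 2 := by
  classical
  have hcard : ((Finset.univ.erase i).card : R) = Fintype.card ι - 1 := by
    rw [Finset.cast_card_erase_of_mem (Finset.mem_univ i), Finset.card_univ]
  have hothers : ∑ j ∈ Finset.univ.erase i, c j = -c i := by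
    rw [← Finset.add_sum_erase _ _ (Finset.mem_univ i)] at hc
    linear_combination hc
  have hCS := sq_sum_le_card_mul_sum_sq (s := Finset.univ.erase i) (f := c)
  rw [hcard, hothers] at hCS
  rw [← Finset.add_sum_erase _ _ (Finset.mem_univ i)]
  linear_combination hCS

theorem neg_card_mul_le_sum_mul {a b : ι → R} (ha : ∑ j, a j = 0) (hb : ∑ j, b j = 0) {i : ι}
    (hai : ∀ j, a j ≤ a i) (hbi : ∀ j, b j ≤ b i) :
    -(Fintype.card ι * (a i * b i)) ≤ ∑ j, a j * b j := by
  have hpos : 0 ≤ ∑ j, (a i - a j) * (b i - b j) :=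
    Finset.sum_nonneg fun j _ => mul_nonneg (sub_nonneg.2 (hai j)) (sub_nonneg.2 (hbi j))
  have hexpand : ∑ j, (a i - a j) * (b i - b j) =
      Fintype.card ι * (a i * b i) + ∑ j, a j * b j := by
    simp only [sub_mul, mul_sub, Finset.sum_sub_distrib, ← Finset.mul_sum, ← Finset.sum_mul, ha,
      hb, Finset.sum_const, Finset.card_univ, nsmul_eq_mul]
    ring
  linarith

theorem neg_card_sub_one_mul_le_sum_mul {a b : ι → R} (ha : ∑ j, a j = 0) (hb : ∑ j, b j = 0)
    {i : ι} (hai : ∀ j, a j ≤ a i) (hbi : ∀ j, b j ≤ b i) :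
    -((Fintype.card ι - 1) * (∑ j, a j ^ 2 + ∑ j, b j ^ 2)) ≤
      2 * (Fintype.card ι + 1) * ∑ j, a j * b j := by
  have hmul := neg_card_mul_le_sum_mul ha hb hai hbi
  have hsq := card_mul_sq_le_of_sum_eq_zero (c := a + b)
    (by simp [Finset.sum_add_distrib, ha, hb]) i
  have hexpand : ∑ j, (a + b) j ^ 2 = ∑ j, a j ^ 2 + 2 * ∑ j, a j * b j + ∑ j, b j ^ 2 := by
    simp only [Pi.add_apply, add_sq, Finset.sum_add_distrib, Finset.mul_sum, mul_assoc]
  have hamgm : 4 * (a i * b i) ≤ (a + b) i ^ 2 := by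
    rw [Pi.add_apply]
    linear_combination sq_nonneg (a i - b i)
  have hmul' := mul_le_mul_of_nonneg_left hamgm (Nat.cast_nonneg (α := R) (Fintype.card ι))
  rw [hexpand] at hsq
  linear_combination 4 * hmul + hsq + hmul'

end SumEqZero

theorem arccos_neg_one_half : Real.arccos (-(1 / 2)) = 2 * π / 3 := by
  rw [Real.arccos_neg, ← Real.cos_pi_div_three,
    Real.arccos_cos (by positivity) (by linarith [Real.pi_pos])]
  ring

/-! ### The Gromov–Hausdorff distance and correspondences -/

theorem isCorrespondence_graphRel {X Y : Type*} {f : Y → X} (hf : Function.Surjective f) :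
    IsCorrespondence (graphRel f) := by
  refine ⟨Set.eq_univ_of_forall fun x => ?_, Set.eq_univ_of_forall fun y => ⟨(f y, y), rfl, rfl⟩⟩
  obtain ⟨y, rfl⟩ := hf x
  exact ⟨(f y, y), rfl, rfl⟩

section GromovHausdorff

variable {X Y : Type*} [MetricSpace X] [MetricSpace Y]

theorem distortion_graphRel_le {f : Y → X} {D : ℝ} (hf : DistortionLE f D) :
    distortion (graphRel f) ≤ ENNReal.ofReal D := by
  refine iSup₂_le fun p hp => iSup₂_le fun q hq => ENNReal.ofReal_le_ofReal ?_
  rw [← show f p.2 = p.1 from hp, ← show f q.2 = q.1 from hq]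
  exact hf _ _

variable [CompactSpace X] [Nonempty X] [CompactSpace Y] [Nonempty Y]

theorem ghDist_le_half_of_surjective {f : Y → X} (hf : Function.Surjective f) {D : ℝ}
    (hD : DistortionLE f D) : GromovHausdorff.ghDist X Y ≤ D / 2 := by
  have h := GromovHausdorff.ghDist_le_of_approx_subsets (s := (Set.univ : Set Y))
    (fun y => f y.1) (ε₁ := 0) (ε₂ := D) (ε₃ := 0) (fun y => ⟨y, trivial, (dist_self y).le⟩)
    (hf.forall.2 fun y => ⟨⟨y, trivial⟩, (dist_self _).le⟩)
    (fun y z => (abs_sub_comm _ _).trans_le (hD y z))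
  rw [GromovHausdorff.ghDist, dist_comm]
  simpa [GromovHausdorff.ghDist] using h

theorem exists_distortionLE_of_ghDist_lt {r : ℝ} (hr : GromovHausdorff.ghDist X Y < r) :
    ∃ g : Y → X, DistortionLE g (2 * r) := by
  obtain ⟨Φ, Ψ, hΦ, hΨ, hΦΨ⟩ := GromovHausdorff.ghDist_eq_hausdorffDist X Y
  have exists_near (y : Y) : ∃ x, dist (Φ x) (Ψ y) < r := by
    obtain ⟨_, ⟨x, rfl⟩, hx⟩ := exists_dist_lt_of_hausdorffDist_lt' (Set.mem_range_self y)
      (hΦΨ ▸ hr) (hausdorffEDist_ne_top_of_nonempty_of_bounded (Set.range_nonempty _)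
        (Set.range_nonempty _) (isCompact_range hΦ.continuous).isBounded
        (isCompact_range hΨ.continuous).isBounded)
    exact ⟨x, hx⟩
  choose g hg using exists_near
  refine ⟨g, fun x y => ?_⟩
  rw [← hΦ.dist_eq, ← hΨ.dist_eq, ← Real.dist_eq]
  exact (dist_dist_dist_le _ _ _ _).trans (by linarith [hg x, hg y])

end GromovHausdorff

namespace GeoSphere

variable {m n : ℕ}

@[simp]
theorem neg_val (x : GeoSphere m) : (-x).val = -x.val := rfl

instance : InvolutiveNeg (GeoSphere m) where
  neg_neg x := GeoSphere.ext (neg_neg x.val)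

theorem dist_neg_right (x y : GeoSphere m) : dist x (-y) = π - dist x y := by
  rw [dist_def, dist_def, neg_val, inner_neg_right, Real.arccos_neg]

theorem dist_neg_left (x y : GeoSphere m) : dist (-x) y = π - dist x y := by
  rw [dist_comm, dist_neg_right, dist_comm]

theorem isometry_neg : Isometry (Neg.neg : GeoSphere m → GeoSphere m) :=
  .of_dist_eq fun x y => by rw [dist_neg_right, dist_neg_left, sub_sub_cancel]

theorem dist_le_pi (x y : GeoSphere m) : dist x y ≤ π := Real.arccos_le_pi _

theorem inner_mem_Icc (x y : GeoSphere m) : inner ℝ x.val y.val ∈ Set.Icc (-1 : ℝ) 1 := by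
  have h := abs_real_inner_le_norm x.val y.val
  rw [x.norm_val, y.norm_val, mul_one] at h
  exact abs_le.1 h

theorem dist_le_dist_iff {x y x' y' : GeoSphere m} :
    dist x y ≤ dist x' y' ↔ inner ℝ x'.val y'.val ≤ inner ℝ x.val y.val :=
  Real.strictAntiOn_arccos.le_iff_ge (inner_mem_Icc x y) (inner_mem_Icc x' y')

theorem dist_le_two_pi_div_three_iff {x y : GeoSphere m} :
    dist x y ≤ 2 * π / 3 ↔ -(1 / 2) ≤ inner ℝ x.val y.val := by
  rw [← arccos_neg_one_half]
  exact Real.strictAntiOn_arccos.le_iff_ge (inner_mem_Icc x y) (by norm_num)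

theorem two_pi_div_three_le_dist_iff {x y : GeoSphere m} :
    2 * π / 3 ≤ dist x y ↔ inner ℝ x.val y.val ≤ -(1 / 2) := by
  rw [← arccos_neg_one_half]
  exact Real.strictAntiOn_arccos.le_iff_ge (by norm_num) (inner_mem_Icc x y)

theorem continuous_of_continuous_val {X : Type*} [TopologicalSpace X] {f : X → GeoSphere m}
    (hf : Continuous fun x => (f x).val) : Continuous f := by
  refine continuous_iff_continuousAt.2 fun x => tendsto_iff_dist_tendsto_zero.2 ?_
  have hdist : Continuous fun y => dist (f y) (f x) :=
    Real.continuous_arccos.comp (hf.inner continuous_const)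
  simpa only [dist_self] using hdist.tendsto x

/-! ### The equator and antipode preserving maps -/

/-- The orthogonal projection of `p` to the hyperplane of the equator: `p` without its last
coordinate. -/
noncomputable def equatorialPart (p : GeoSphere (m + 1)) : EuclideanSpace ℝ (Fin (m + 1)) :=
  WithLp.toLp 2 fun i => p.val i.castSucc

theorem inner_val (p q : GeoSphere (m + 1)) :
    inner ℝ p.val q.val = inner ℝ p.equatorialPart q.equatorialPart +
      p.val (Fin.last (m + 1)) * q.val (Fin.last (m + 1)) := by
  simp only [PiLp.inner_apply, Fin.sum_univ_castSucc (n := m + 1), equatorialPart,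
    RCLike.inner_apply, conj_trivial, mul_comm]

theorem norm_equatorialPart_sq (p : GeoSphere (m + 1)) :
    ‖p.equatorialPart‖ ^ 2 = 1 - p.val (Fin.last (m + 1)) ^ 2 := by
  have h := inner_val p p
  rw [real_inner_self_eq_norm_sq, real_inner_self_eq_norm_sq, p.norm_val] at h
  linear_combination -h

@[simp]
theorem equatorial_val_last (x : GeoSphere m) : x.equatorial.val (Fin.last (m + 1)) = 0 := by
  simp [equatorial]

@[simp]
theorem equatorialPart_equatorial (x : GeoSphere m) : x.equatorial.equatorialPart = x.val := by
  ext i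
  simp [equatorialPart, equatorial]

theorem ext_equatorialPart {p q : GeoSphere (m + 1)} (h : p.equatorialPart = q.equatorialPart)
    (hlast : p.val (Fin.last (m + 1)) = q.val (Fin.last (m + 1))) : p = q := by
  ext i
  exact Fin.lastCases hlast (fun i => congrArg (fun v => v i) h) i

theorem inner_equatorial_right (p : GeoSphere (m + 1)) (x : GeoSphere m) :
    inner ℝ p.val x.equatorial.val = inner ℝ p.equatorialPart x.val := by
  rw [inner_val, equatorial_val_last, equatorialPart_equatorial, mul_zero, add_zero]

theorem isometry_equatorial : Isometry (equatorial (m := m)) :=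
  .of_dist_eq fun x y => by
    rw [dist_def, dist_def, inner_equatorial_right, equatorialPart_equatorial]

theorem neg_equatorial (x : GeoSphere m) : -x.equatorial = (-x).equatorial := by
  refine ext_equatorialPart ?_ (by simp)
  rw [equatorialPart_equatorial, neg_val, ← equatorialPart_equatorial x]
  rfl

theorem exists_equatorial_eq {p : GeoSphere (m + 1)} (h : p.val (Fin.last (m + 1)) = 0) :
    ∃ x : GeoSphere m, x.equatorial = p := by
  refine ⟨⟨p.equatorialPart, ?_⟩, ext_equatorialPart (equatorialPart_equatorial _) (by simp [h])⟩
  rw [← pow_eq_one_iff_of_nonneg (norm_nonneg _) two_ne_zero, norm_equatorialPart_sq, h]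
  norm_num

theorem mem_helmet_or_neg_mem : ∀ {n : ℕ} (x : GeoSphere n), x ∈ helmet n ∨ -x ∈ helmet n
  | 0, x => by
    have hx : |x.val 0| = 1 := by
      simpa [EuclideanSpace.norm_eq, Real.sqrt_sq_eq_abs] using x.norm_val
    simpa only [helmet, Set.mem_ofPred_eq, neg_val, PiLp.neg_apply, neg_eq_iff_eq_neg] using
      eq_or_eq_neg_of_abs_eq hx
  | n + 1, x => by
    rcases lt_trichotomy (x.val (Fin.last (n + 1))) 0 with hx | hx | hx
    · exact .inr (.inl (neg_pos.2 hx))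
    · obtain ⟨y, rfl⟩ := exists_equatorial_eq hx
      rw [neg_equatorial]
      exact (mem_helmet_or_neg_mem y).imp (fun h => .inr ⟨y, h, rfl⟩) (fun h => .inr ⟨-y, h, rfl⟩)
    · exact .inl (.inl hx)

theorem openUpperHemisphere_subset : openUpperHemisphere m ⊆ closedUpperHemisphere m :=
  fun _ h => le_of_lt (Set.mem_ofPred_eq ▸ h)

theorem helmet_subset_closedUpperHemisphere : ∀ n, helmet n ⊆ closedUpperHemisphere n
  | 0, _, hx => zero_le_one.trans_eq (Eq.symm hx)
  | _ + 1, _, .inl hx => openUpperHemisphere_subset hx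
  | _ + 1, _, .inr ⟨y, _, hy⟩ => hy ▸ y.equatorial_mem_closedUpperHemisphere

theorem neg_notMem_helmet : ∀ {n : ℕ} {x : GeoSphere n}, x ∈ helmet n → -x ∉ helmet n
  | 0, x, hx, hx' => by
    simp only [helmet, Set.mem_ofPred_eq, neg_val, PiLp.neg_apply] at hx hx'
    linarith
  | n + 1, _, .inl hx, hx' =>
    (neg_neg_of_pos (Set.mem_ofPred_eq ▸ hx)).not_ge (helmet_subset_closedUpperHemisphere _ hx')
  | n + 1, _, .inr ⟨y, hy, rfl⟩, hy' => by
    rw [neg_equatorial] at hy'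
    rcases hy' with hy' | ⟨z, hz, hzy⟩
    · exact (equatorial_val_last (-y)).not_gt hy'
    · exact neg_notMem_helmet hy (isometry_equatorial.injective hzy ▸ hz)

open Classical in
/-- The antipode preserving map on the sphere that extends a map `f` on the helmet, a set
containing exactly one point of each antipodal pair. -/
noncomputable def oddExtension (f : helmet n → GeoSphere m) (x : GeoSphere n) : GeoSphere m :=
  if hx : x ∈ helmet n then f ⟨x, hx⟩
  else -f ⟨-x, (mem_helmet_or_neg_mem x).resolve_left hx⟩

theorem domRestrict_oddExtension (f : helmet n → GeoSphere m) :
    (helmet n).domRestrict (oddExtension f) = f :=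
  funext fun x => dif_pos x.2

theorem oddExtension_neg (f : helmet n → GeoSphere m) (x : GeoSphere n) :
    oddExtension f (-x) = -oddExtension f x := by
  by_cases hx : x ∈ helmet n
  · simp only [oddExtension, hx, neg_notMem_helmet hx, neg_neg, dite_true, dite_false]
  · simp only [oddExtension, hx, (mem_helmet_or_neg_mem x).resolve_left hx, neg_neg, dite_true,
      dite_false]

theorem distortionLE_of_domRestrict_helmet {φ : GeoSphere n → GeoSphere m}
    (hodd : ∀ x, φ (-x) = -φ x) {D : ℝ} (h : DistortionLE ((helmet n).domRestrict φ) D) :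
    DistortionLE φ D := by
  have neg_left (x y : GeoSphere n) :
      |dist (φ (-x)) (φ y) - dist (-x) y| = |dist (φ x) (φ y) - dist x y| := by
    rw [hodd, dist_neg_left, dist_neg_left, sub_sub_sub_cancel_left, abs_sub_comm]
  have neg_right (x y : GeoSphere n) :
      |dist (φ x) (φ (-y)) - dist x (-y)| = |dist (φ x) (φ y) - dist x y| := by
    rw [hodd, dist_neg_right, dist_neg_right, sub_sub_sub_cancel_left, abs_sub_comm]
  intro x y
  rcases mem_helmet_or_neg_mem x with hx | hx <;> rcases mem_helmet_or_neg_mem y with hy | hy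
  · exact h ⟨x, hx⟩ ⟨y, hy⟩
  · exact neg_right x y ▸ h ⟨x, hx⟩ ⟨-y, hy⟩
  · exact neg_left x y ▸ h ⟨-x, hx⟩ ⟨y, hy⟩
  · exact neg_right x y ▸ neg_left x (-y) ▸ h ⟨-x, hx⟩ ⟨-y, hy⟩

/-! ### The lower bound -/

theorem exists_eq_zero_of_odd {F : GeoSphere (m + 2) → EuclideanSpace ℝ (Fin 2)}
    (hF : Continuous F) (hodd : ∀ x, F (-x) = -F x) : ∃ x, F x = 0 := by
  let ofSphere (x : sphere (0 : EuclideanSpace ℝ (Fin (m + 2 + 1))) 1) : GeoSphere (m + 2) :=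
    ⟨x, norm_eq_of_mem_sphere x⟩
  have continuous_ofSphere : Continuous ofSphere :=
    continuous_of_continuous_val continuous_subtype_val
  let e : EuclideanSpace ℝ (Fin 2) ≃ₗᵢ[ℝ] ℂ := Complex.orthonormalBasisOneI.repr.symm
  obtain ⟨x, hx⟩ := exists_eq_zero_of_odd_of_two_lt_finrank
    (by rw [finrank_euclideanSpace_fin]; lia)
    (e.continuous.comp (hF.comp continuous_ofSphere))
    fun x => (congrArg e (hodd (ofSphere x))).trans (map_neg e _)
  exact ⟨ofSphere x, e.map_eq_zero_iff.1 hx⟩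

/-- If the values of `g` near each point were close together, averaging them would give a
continuous map whose odd part does not vanish. -/
theorem exists_dist_lt_and_two_pi_div_three_le_dist {g : GeoSphere (m + 2) → GeoSphere 1}
    (hg : ∀ x, g (-x) = -g x) {δ : ℝ} (hδ : 0 < δ) :
    ∃ x y, dist x y < δ ∧ 2 * π / 3 ≤ dist (g x) (g y) := by
  let V (x : GeoSphere (m + 2)) : Set (EuclideanSpace ℝ (Fin 2)) :=
    (fun y => (g y).val) '' ball x (δ / 2)
  have V_neg_subset (x : GeoSphere (m + 2)) : V (-x) ⊆ -V x := by
    rintro _ ⟨y, hy, rfl⟩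
    refine ⟨-y, ?_, congrArg val (hg y)⟩
    rw [mem_ball, ← isometry_neg.dist_eq, neg_neg]
    exact hy
  obtain ⟨F, hF⟩ : ∃ F : C(GeoSphere (m + 2), EuclideanSpace ℝ (Fin 2)),
      ∀ x, F x ∈ convexHull ℝ (V x) := by
    refine exists_continuous_forall_mem_convex_of_local_const (fun x => convex_convexHull ℝ _)
      fun x => ⟨(g x).val, ?_⟩
    filter_upwards [ball_mem_nhds x (half_pos hδ)] with y hy
    exact subset_convexHull ℝ _ ⟨x, mem_ball_comm.1 hy, rfl⟩
  obtain ⟨x, hx⟩ := exists_eq_zero_of_odd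
    (F.continuous.sub (F.continuous.comp isometry_neg.continuous)) fun x => by
      simp only [Pi.sub_apply, Function.comp_apply, neg_neg, neg_sub]
  have neg_mem : -F x ∈ convexHull ℝ (V x) := by
    rw [sub_eq_zero.1 hx, ← Set.mem_neg, ← convexHull_neg]
    exact convexHull_mono (V_neg_subset x) (hF (-x))
  have zero_mem : 0 ∈ convexHull ℝ (V x) := by
    simpa only [midpoint_self_neg] using (convex_convexHull ℝ _).midpoint_mem (hF x) neg_mem
  obtain ⟨_, ⟨y, hy, rfl⟩, _, ⟨z, hz, rfl⟩, hyz⟩ := exists_inner_le_of_zero_mem_convexHull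
    (by rintro _ ⟨y, -, rfl⟩; exact (g y).norm_val) zero_mem
  refine ⟨y, z, ?_, two_pi_div_three_le_dist_iff.2 (by simpa using hyz)⟩
  linarith [dist_triangle_right y z x, mem_ball.1 hy, mem_ball.1 hz]

theorem two_pi_div_three_le_of_distortionLE {g : GeoSphere (m + 2) → GeoSphere 1} {D : ℝ}
    (hg : DistortionLE g D) : 2 * π / 3 ≤ D := by
  let f : helmet (m + 2) → GeoSphere 1 := (helmet (m + 2)).domRestrict g
  have hf : DistortionLE (oddExtension f) D :=
    distortionLE_of_domRestrict_helmet (oddExtension_neg f)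
      ((domRestrict_oddExtension f).symm ▸ fun x y => hg x y)
  refine le_of_forall_pos_le_add fun δ hδ => ?_
  obtain ⟨x, y, hxy, hgxy⟩ := exists_dist_lt_and_two_pi_div_three_le_dist (oddExtension_neg f) hδ
  linarith [(abs_le.1 (hf x y)).2]

theorem pi_div_three_le_ghDist (m : ℕ) :
    π / 3 ≤ GromovHausdorff.ghDist (GeoSphere 1) (GeoSphere (m + 2)) := by
  refine le_of_forall_gt_imp_ge_of_dense fun r hr => ?_
  obtain ⟨g, hg⟩ := exists_distortionLE_of_ghDist_lt hr
  linarith [two_pi_div_three_le_of_distortionLE hg]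

/-! ### The Voronoi map -/

theorem sum_triangle_val : ∑ i, (triangle i).val = 0 := by
  ext k
  simp only [triangle, Fin.sum_univ_three, Matrix.cons_val, PiLp.add_apply, PiLp.zero_apply]
  fin_cases k <;> norm_num

theorem sum_inner_triangle (v : EuclideanSpace ℝ (Fin 2)) :
    ∑ i, inner ℝ v (triangle i).val = 0 := by
  rw [← inner_sum, sum_triangle_val, inner_zero_right]

theorem sum_inner_triangle_mul_inner_triangle (v w : EuclideanSpace ℝ (Fin 2)) :
    ∑ i, inner ℝ v (triangle i).val * inner ℝ w (triangle i).val = 3 / 2 * inner ℝ v w := by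
  have h3 : √3 ^ 2 = (3 : ℝ) := Real.sq_sqrt (by norm_num)
  simp only [triangle, PiLp.inner_apply, RCLike.inner_apply, conj_trivial, Fin.sum_univ_two,
    Fin.sum_univ_three, Matrix.cons_val]
  linear_combination v 1 * w 1 / 2 * h3

theorem dist_triangle_of_ne {i j : Fin 3} (hij : i ≠ j) :
    dist (triangle i) (triangle j) = 2 * π / 3 := by
  have h3 : √3 * √3 = (3 : ℝ) := Real.mul_self_sqrt (by norm_num)
  have h_inner : inner ℝ (triangle i).val (triangle j).val = -(1 / 2 : ℝ) := by
    simp only [triangle, PiLp.inner_apply, RCLike.inner_apply, conj_trivial, Fin.sum_univ_two]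
    fin_cases i <;> fin_cases j <;> first
      | exact absurd rfl hij
      | simp only [Fin.reduceFinMk, Matrix.cons_val]; linarith
  rw [dist_def, h_inner, arccos_neg_one_half]

theorem exists_mem_voronoiCell {p : GeoSphere 2} (hp : p ∈ openUpperHemisphere 2) :
    ∃ i, p ∈ voronoiCell i := by
  obtain ⟨i, hi⟩ := Finite.exists_min fun i => toLex (dist p (triangle i).equatorial, i)
  simp only [Prod.Lex.toLex_le_toLex] at hi
  exact ⟨i, hp, fun j _ => (hi j).elim le_of_lt fun h => h.1.le,
    fun j hj => (hi j).resolve_right fun h => h.2.not_gt hj⟩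

theorem eq_of_mem_voronoiCell {p : GeoSphere 2} {i j : Fin 3} (hi : p ∈ voronoiCell i)
    (hj : p ∈ voronoiCell j) : i = j := by
  rcases lt_trichotomy i j with h | h | h
  · exact absurd (hi.2.1 j h.ne') (hj.2.2 i h).not_ge
  · exact h
  · exact absurd (hj.2.1 i h.ne') (hi.2.2 j h).not_ge

theorem equatorial_notMem_voronoiCell (x : GeoSphere 1) (i : Fin 3) :
    x.equatorial ∉ voronoiCell i :=
  fun h => (equatorial_val_last x).not_gt h.1

theorem exists_mem_voronoiCell_or_exists_equatorial_eq {p : GeoSphere 2}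
    (hp : p ∈ closedUpperHemisphere 2) :
    (∃ i, p ∈ voronoiCell i) ∨ ∃ x : GeoSphere 1, x.equatorial = p :=
  (lt_or_eq_of_le (Set.mem_ofPred_eq ▸ hp)).imp exists_mem_voronoiCell
    fun h => exists_equatorial_eq (Eq.symm h)

theorem exists_isVoronoiMap : ∃ ψ, IsVoronoiMap ψ := by
  have exists_value (p : closedUpperHemisphere 2) : ∃ y : GeoSphere 1,
      (∀ i, p.1 ∈ voronoiCell i → y = triangle i) ∧
      (∀ x : GeoSphere 1, x.equatorial = p.1 → y = x) := by
    obtain ⟨p, hp⟩ := p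
    rcases exists_mem_voronoiCell_or_exists_equatorial_eq hp with ⟨i, hi⟩ | ⟨y, rfl⟩
    · refine ⟨triangle i, fun j hj => congrArg triangle (eq_of_mem_voronoiCell hi hj), ?_⟩
      rintro x rfl
      exact absurd hi (equatorial_notMem_voronoiCell x i)
    · exact ⟨y, fun i hi => absurd hi (equatorial_notMem_voronoiCell y i),
        fun x hx => (isometry_equatorial.injective hx).symm⟩
  choose ψ hψ using exists_value
  exact ⟨ψ, fun i p => (hψ p).1 i, fun x => (hψ _).2 x rfl⟩

theorem inner_triangle_le_of_mem_voronoiCell {p : GeoSphere 2} {i : Fin 3}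
    (hp : p ∈ voronoiCell i) (j : Fin 3) :
    inner ℝ p.equatorialPart (triangle j).val ≤ inner ℝ p.equatorialPart (triangle i).val := by
  rcases eq_or_ne j i with rfl | hj
  · exact le_rfl
  · simpa only [dist_le_dist_iff, inner_equatorial_right] using hp.2.1 j hj

theorem dist_le_of_mem_voronoiCell {p q : GeoSphere 2} {i : Fin 3} (hp : p ∈ voronoiCell i)
    (hq : q ∈ voronoiCell i) : dist p q ≤ 2 * π / 3 := by
  have h := neg_card_sub_one_mul_le_sum_mul (sum_inner_triangle p.equatorialPart)
    (sum_inner_triangle q.equatorialPart) (inner_triangle_le_of_mem_voronoiCell hp)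
    (inner_triangle_le_of_mem_voronoiCell hq)
  simp only [sq, sum_inner_triangle_mul_inner_triangle, real_inner_self_eq_norm_mul_norm,
    Fintype.card_fin] at h
  have h_inner : -(‖p.equatorialPart‖ ^ 2 + ‖q.equatorialPart‖ ^ 2) / 4 ≤
      inner ℝ p.equatorialPart q.equatorialPart := by
    norm_num at h
    linarith
  have h_last : 0 < p.val (Fin.last 2) * q.val (Fin.last 2) := mul_pos hp.1 hq.1
  rw [norm_equatorialPart_sq, norm_equatorialPart_sq] at h_inner
  rw [dist_le_two_pi_div_three_iff, inner_val]
  linarith [sq_nonneg (p.val (Fin.last 2)), sq_nonneg (q.val (Fin.last 2))]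

theorem dist_triangle_le_of_mem_voronoiCell {p : GeoSphere 2} {i : Fin 3}
    (hp : p ∈ voronoiCell i) : dist p (triangle i).equatorial ≤ π / 2 := by
  rw [dist_def, Real.arccos_le_pi_div_two, inner_equatorial_right]
  have h := Finset.sum_le_card_nsmul Finset.univ _ _
    fun j _ => inner_triangle_le_of_mem_voronoiCell hp j
  rw [sum_inner_triangle] at h
  simpa using h

theorem abs_dist_triangle_sub_dist_le {p : GeoSphere 2} {i : Fin 3} (hp : p ∈ voronoiCell i)
    (x : GeoSphere 1) : |dist (triangle i) x - dist p x.equatorial| ≤ π / 2 := by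
  rw [← isometry_equatorial.dist_eq]
  exact (abs_dist_sub_le _ _ _).trans ((dist_comm _ _).trans_le
    (dist_triangle_le_of_mem_voronoiCell hp))

section Maps

variable {ψ : closedUpperHemisphere 2 → GeoSphere 1} {φ : GeoSphere 2 → GeoSphere 1}

theorem IsVoronoiMap.distortionLE (hψ : IsVoronoiMap ψ) : DistortionLE ψ (2 * π / 3) := by
  rintro ⟨p, hp⟩ ⟨q, hq⟩
  rw [Subtype.dist_eq]
  have hπ : π / 2 ≤ 2 * π / 3 := by linarith [Real.pi_pos]
  rcases exists_mem_voronoiCell_or_exists_equatorial_eq hp with ⟨i, hi⟩ | ⟨x, rfl⟩ <;>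
    rcases exists_mem_voronoiCell_or_exists_equatorial_eq hq with ⟨j, hj⟩ | ⟨y, rfl⟩
  · rw [hψ.1 i ⟨p, hp⟩ hi, hψ.1 j ⟨q, hq⟩ hj]
    rcases eq_or_ne i j with rfl | hij
    · rw [dist_self, zero_sub, abs_neg, abs_of_nonneg dist_nonneg]
      exact dist_le_of_mem_voronoiCell hi hj
    · rw [dist_triangle_of_ne hij, abs_le]
      constructor <;> linarith [dist_le_pi p q, dist_nonneg (x := p) (y := q)]
  · rw [hψ.1 i ⟨p, hp⟩ hi, hψ.2]
    exact (abs_dist_triangle_sub_dist_le hi y).trans hπ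
  · rw [hψ.1 j ⟨q, hq⟩ hj, hψ.2, dist_comm, dist_comm x.equatorial]
    exact (abs_dist_triangle_sub_dist_le hj x).trans hπ
  · rw [hψ.2, hψ.2, isometry_equatorial.dist_eq, sub_self, abs_zero]
    positivity

theorem IsVoronoiMap.surjective (hψ : IsVoronoiMap ψ) : Function.Surjective ψ :=
  fun x => ⟨_, hψ.2 x⟩

theorem exists_isOddExtension (ψ : closedUpperHemisphere 2 → GeoSphere 1) :
    ∃ φ, IsOddExtension ψ φ := by
  let f (p : helmet 2) : GeoSphere 1 := ψ ⟨p, helmet_subset_closedUpperHemisphere 2 p.2⟩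
  exact ⟨oddExtension f, oddExtension_neg f,
    fun p hp => congrFun (domRestrict_oddExtension f) ⟨p.1, hp⟩⟩

theorem IsOddExtension.distortionLE (hφ : IsOddExtension ψ φ) {D : ℝ} (hψ : DistortionLE ψ D) :
    DistortionLE φ D := by
  refine distortionLE_of_domRestrict_helmet hφ.1 fun ⟨p, hp⟩ ⟨q, hq⟩ => ?_
  rw [Set.domRestrict_apply, Set.domRestrict_apply,
    hφ.2 ⟨p, helmet_subset_closedUpperHemisphere 2 hp⟩ hp,
    hφ.2 ⟨q, helmet_subset_closedUpperHemisphere 2 hq⟩ hq]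
  exact hψ _ _

theorem IsOddExtension.surjective (hφ : IsOddExtension ψ φ) (hψ : IsVoronoiMap ψ) :
    Function.Surjective φ := fun x => by
  have apply_equatorial {y : GeoSphere 1} (hy : y.equatorial ∈ helmet 2) : φ y.equatorial = y :=
    (hφ.2 ⟨_, y.equatorial_mem_closedUpperHemisphere⟩ hy).trans (hψ.2 y)
  rcases mem_helmet_or_neg_mem x.equatorial with hx | hx
  · exact ⟨_, apply_equatorial hx⟩
  · rw [neg_equatorial] at hx
    exact ⟨-(-x).equatorial, by rw [hφ.1, apply_equatorial hx, neg_neg]⟩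

end Maps

end GeoSphere

theorem mainTheorem2 :
    (∃ (R₁ : Set (GeoSphere 1 × GeoSphere.closedUpperHemisphere 2))
        (R₂ : Set (GeoSphere 1 × GeoSphere 2)),
      (IsCorrespondence R₁ ∧ distortion R₁ ≤ ENNReal.ofReal (2 * Real.pi / 3)) ∧
      (IsCorrespondence R₂ ∧ distortion R₂ ≤ ENNReal.ofReal (2 * Real.pi / 3)) ∧
      (∃ (ψ : GeoSphere.closedUpperHemisphere 2 → GeoSphere 1) (φ : GeoSphere 2 → GeoSphere 1),
        GeoSphere.IsVoronoiMap ψ ∧ GeoSphere.IsOddExtension ψ φ ∧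
          R₁ = graphRel ψ ∧ R₂ = graphRel φ)) ∧
    GromovHausdorff.ghDist (GeoSphere 1) (GeoSphere 2) = Real.pi / 3 := by
  obtain ⟨ψ, hψ⟩ := GeoSphere.exists_isVoronoiMap
  obtain ⟨φ, hφ⟩ := GeoSphere.exists_isOddExtension ψ
  have ψ_dis : DistortionLE ψ (2 * π / 3) := hψ.distortionLE
  have φ_dis : DistortionLE φ (2 * π / 3) := hφ.distortionLE ψ_dis
  have φ_surj : Function.Surjective φ := hφ.surjective hψ
  refine ⟨⟨graphRel ψ, graphRel φ,
    ⟨isCorrespondence_graphRel hψ.surjective, distortion_graphRel_le ψ_dis⟩,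
    ⟨isCorrespondence_graphRel φ_surj, distortion_graphRel_le φ_dis⟩,
    ψ, φ, hψ, hφ, rfl, rfl⟩, le_antisymm ?_ (GeoSphere.pi_div_three_le_ghDist 0)⟩
  calc GromovHausdorff.ghDist (GeoSphere 1) (GeoSphere 2) ≤ 2 * π / 3 / 2 :=
        ghDist_le_half_of_surjective φ_surj φ_dis
    _ = π / 3 := by ring
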